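/- Let $K_{n+1}$ be the complete graph on the vertices $v_1,\dots,v_{n+1}$ with every edge directed from the smaller to the larger index, and for ${\bf a}\in\mathbb{N}^n$ let $\mathrm{Flow}_n({\bf a})$ be the polytope of all non-negative flows on $K_{n+1}$ with netflow vector $(a_1,\dots,a_n,-\sum_i a_i)$, i.e. of all $\phi: E(K_{n+1})\to\mathbb{R}_{\ge 0}$ with $\sum_{e=(v_i,v_j)}\phi(e)-\sum_{e=(v_k,v_i)}\phi(e)=a_i$ for $1\le i\le n$. Let $CRY_n=\mathrm{Flow}_n(1,0,\dots,0)$ be the Chan–Robbins–Yuen polytope, and let $f^{(n)}(x)=\sum_{d\ge -1}f^{(n)}_d x^d$ be its $f$-polynomial, a Laurent polynomial in which $f^{(n)}_d$ is the number of $d$-dimensional faces of $CRY_n$, the empty face (of dimension $-1$) included. Let $\widetilde f^{(n)}(x)=\sum_H x^{\beta_1(H)}$ be the primitive $f$-polynomial of $CRY_n$, where $H$ runs over the primitive $(1,0,\dots,0)$-valid subgraphs of $K_{n+1}$, that is, the connected subgraphs $H$ with vertex set $\{v_1,\dots,v_{n+1}\}$ whose edge set is the support of a non-negative flow with netflow vector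 $(1,0,\dots,0,-1)$, and where $\beta_1(H)=|E(H)|-|V(H)|+c(H)$ is the first Betti number ($c(H)$ being the number of connected components). For $n=0$ the netflow vector is $(0)$, and the only such $H$ is the single vertex $v_1$, so that $\widetilde f^{(0)}(x)=1$. Then for all $n\ge 1$ $$x\,f^{(n)}(x)=(1+x)^{n}\,\widetilde f^{(n-1)}(x).$$ In particular (setting $x=1$), the total number of faces of $CRY_n$, the empty face included, is $2^n$ times the number of primitive $(1,0,\dots,0)$-valid subgraphs of $K_n$. -/

import Mathlib

open scoped LaurentPolynomial

/-! ### Faces and the `f`-polynomial of a polytope -/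

section Faces

variable {E : Type*} [AddCommGroup E] [Module ℝ E] [TopologicalSpace E]

/-- The faces of a polytope `P`: the empty face, and the sets of points of `P` at which some
linear functional attains its maximum over `P` (the zero functional gives `P` itself). -/
def polytopeFaces (P : Set E) : Set (Set E) :=
  {F | IsExposed ℝ P F}

open Classical in
/-- The dimension of a face: the dimension of its affine hull, and `-1` for the empty face. -/
noncomputable def faceDim (F : Set E) : ℤ :=
  if F = ∅ then -1 else (Module.finrank ℝ (vectorSpan ℝ F) : ℤ)

/-- The entry `f_d` of the `f`-vector of `P`: the number of `d`-dimensional faces. -/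
noncomputable def fVector (P : Set E) (d : ℤ) : ℕ :=
  {F ∈ polytopeFaces P | faceDim F = d}.ncard

/-- The `f`-polynomial `∑_{d ≥ -1} f_d x^d` of `P`, as a Laurent polynomial in `x = T 1`.
Face dimensions lie between `-1` and the dimension of the ambient space. -/
noncomputable def fPolynomial (P : Set E) : ℤ[T;T⁻¹] :=
  ∑ d ∈ Finset.Icc (-1 : ℤ) (Module.finrank ℝ E),
    LaurentPolynomial.C (fVector P d : ℤ) * LaurentPolynomial.T d

end Faces

/-! ### Flow polytopes of the complete graph -/

/-- The edges `(i, j)`, `i < j`, of the transitively directed complete graph `K_{n+1}`, whose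
vertices `v_1, …, v_{n+1}` are the elements `0, …, n` of `Fin (n + 1)`. -/
abbrev KEdge (n : ℕ) : Type :=
  {e : Fin (n + 1) × Fin (n + 1) // e.1 < e.2}

/-- `f` is a (non-negative) flow on `K_{n+1}` with netflow `(a_1, …, a_n, -∑ a_i)`: at each of the
first `n` vertices, outgoing flow minus incoming flow is `a_i`. Conservation at the last vertex
is a consequence. -/
def IsFlow {n : ℕ} (a : Fin n → ℕ) (f : KEdge n → ℝ) : Prop :=
  (∀ e, 0 ≤ f e) ∧
    ∀ i : Fin n,
      (∑ e : KEdge n with e.1.1 = i.castSucc, f e) -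
        (∑ e : KEdge n with e.1.2 = i.castSucc, f e) = (a i : ℝ)

/-- The flow polytope `Flow_n(a)`. -/
def flowPolytope {n : ℕ} (a : Fin n → ℕ) : Set (KEdge n → ℝ) :=
  {f | IsFlow a f}

/-- The netflow vector `(1, 0, …, 0)` of length `n`. -/
def cryNetflow (n : ℕ) : Fin n → ℕ :=
  fun i => if (i : ℕ) = 0 then 1 else 0

/-- The Chan-Robbins-Yuen polytope, as the flow polytope `Flow_n(1, 0, …, 0)`. -/
def cryPolytope (n : ℕ) : Set (KEdge n → ℝ) :=
  flowPolytope (cryNetflow n)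

/-! ### Valid and primitive subgraphs -/

/-- The undirected graph on all of `v_1, …, v_{n+1}` underlying a set `H` of edges. -/
def underlyingGraph {n : ℕ} (H : Finset (KEdge n)) : SimpleGraph (Fin (n + 1)) :=
  SimpleGraph.fromRel fun u v => ∃ e ∈ H, e.1 = (u, v)

/-- The first Betti number `|E(H)| - |V(H)| + c(H)`. Adding isolated vertices to a
graph does not change it, so `H` is taken with the full vertex set. -/
noncomputable def firstBetti {n : ℕ} (H : Finset (KEdge n)) : ℤ :=
  (H.card : ℤ) - ((n + 1 : ℕ) : ℤ) + (Nat.card (underlyingGraph H).ConnectedComponent : ℤ)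

/-- `H` is `a`-valid: it is the support of a flow with netflow `a`. -/
def IsValidSubgraph {n : ℕ} (a : Fin n → ℕ) (H : Finset (KEdge n)) : Prop :=
  ∃ f : KEdge n → ℝ, IsFlow a f ∧ ∀ e, e ∈ H ↔ f e ≠ 0

/-- `H` is primitive: it is connected and uses all the vertices `v_1, …, v_{n+1}`. -/
def IsPrimitiveSubgraph {n : ℕ} (H : Finset (KEdge n)) : Prop :=
  (underlyingGraph H).Connected

open Classical in
/-- The primitive `a`-valid subgraphs of `K_{n+1}`. -/
noncomputable def primitiveValidSubgraphs {n : ℕ} (a : Fin n → ℕ) :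
    Finset (Finset (KEdge n)) :=
  {H | IsValidSubgraph a H ∧ IsPrimitiveSubgraph H}

/-- The primitive `f`-polynomial of `Flow_n(a)`: the generating function of the primitive
`a`-valid subgraphs of `K_{n+1}` by first Betti number. -/
noncomputable def primitiveFPolynomial {n : ℕ} (a : Fin n → ℕ) : ℤ[T;T⁻¹] :=
  ∑ H ∈ primitiveValidSubgraphs a, LaurentPolynomial.T (firstBetti H)

/-! Non-empty faces of the polytope correspond to valid subgraphs `H`, the supports of its points
(`exists_eq_cryFace`, `cryFace_injOn`), and the dimension of a face is the Betti number of `H`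
(`faceDim_cryFace`). Validity and primitivity are local: they depend only on which vertices have an
edge in and which have an edge out (`isValidSubgraph_iff`, `isPrimitive_valid_iff`). So does the
number of components of a valid graph, since each component has exactly one vertex without edges
out. For `n ≥ 1`, the edgeless graph satisfies the interior balance condition without being valid;
it stands for the empty face.

Up to a power of `x`, both polynomials are thus sums over all subgraphs of `x ^ |H|` times a product
of vertex weights. Deleting the last vertex gives a recursion for such sums (`graphSum_succ`). A
parameter `B`, the weight of all choices of edges to vertices already deleted, closes the recursion:
each deletion replaces `B` by `(1 + x) * B`. With `Q k B` and `P k B` for the balanced and the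
primitive sums, induction yields `Q (k+1) ((1+x) B) = (1+x)^(k+2) B (P k ((1+x) B) - P k B)`
(`graphSum_balancedWeight_eq`), and `B = 1` is the theorem for `n = k + 2`. -/

/-! ### Degrees in subgraphs of the complete graph -/

/-- Some edge of `H` ends in `v`. -/
def HasIn {n : ℕ} (H : Finset (KEdge n)) (v : Fin (n + 1)) : Prop :=
  ∃ e ∈ H, e.1.2 = v

/-- Some edge of `H` starts in `v`. -/
def HasOut {n : ℕ} (H : Finset (KEdge n)) (v : Fin (n + 1)) : Prop :=
  ∃ e ∈ H, e.1.1 = v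

theorem HasIn.ne_zero {n : ℕ} {H : Finset (KEdge n)} {v : Fin (n + 1)} (h : HasIn H v) :
    v ≠ 0 := by
  obtain ⟨e, -, rfl⟩ := h
  exact Fin.ne_zero_of_lt e.2

theorem HasOut.ne_last {n : ℕ} {H : Finset (KEdge n)} {v : Fin (n + 1)} (h : HasOut H v) :
    v ≠ Fin.last n := by
  obtain ⟨e, -, rfl⟩ := h
  exact Fin.ne_last_of_lt e.2

/-! ### Adding a last vertex -/

/-- The edges of `K_{k+2}` are those of `K_{k+1}` and the edges into the last vertex. -/
def edgeInsert (k : ℕ) : KEdge k ⊕ Fin (k + 1) → KEdge (k + 1)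
  | .inl e => ⟨(e.1.1.castSucc, e.1.2.castSucc), by simpa using e.2⟩
  | .inr v => ⟨(v.castSucc, Fin.last _), Fin.castSucc_lt_last v⟩

theorem edgeInsert_bijective (k : ℕ) : Function.Bijective (edgeInsert k) := by
  constructor
  · rintro (⟨⟨a, b⟩, h⟩ | v) (⟨⟨c, d⟩, h'⟩ | u) <;>
      simp [edgeInsert, Fin.ext_iff] <;> omega
  · rintro ⟨⟨a, b⟩, h⟩
    have ha : a ≠ Fin.last _ := Fin.ne_last_of_lt h
    obtain ⟨a, rfl⟩ := Fin.exists_castSucc_eq.2 ha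
    by_cases hb : b = Fin.last _
    · subst hb
      exact ⟨.inr a, rfl⟩
    · obtain ⟨b, rfl⟩ := Fin.exists_castSucc_eq.2 hb
      exact ⟨.inl ⟨(a, b), by simpa using h⟩, rfl⟩

/-- `KEdge (k + 1)` as the disjoint union of `KEdge k` and the edges into the last vertex. -/
noncomputable def edgeEquiv (k : ℕ) : KEdge k ⊕ Fin (k + 1) ≃ KEdge (k + 1) :=
  Equiv.ofBijective _ (edgeInsert_bijective k)

/-- The subgraph with restriction `p.1` to the first vertices, and with the in-neighbours `p.2`
of the last vertex. -/
noncomputable def graphEquiv (k : ℕ) :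
    Finset (KEdge k) × Finset (Fin (k + 1)) ≃ Finset (KEdge (k + 1)) :=
  Finset.sumEquiv.toEquiv.symm.trans (edgeEquiv k).finsetCongr

theorem mem_graphEquiv {k : ℕ} (p : Finset (KEdge k) × Finset (Fin (k + 1)))
    (e : KEdge (k + 1)) :
    e ∈ graphEquiv k p ↔
      (∃ a ∈ p.1, edgeInsert k (.inl a) = e) ∨ ∃ v ∈ p.2, edgeInsert k (.inr v) = e := by
  have h : graphEquiv k p = (p.1.disjSum p.2).map (edgeEquiv k).toEmbedding := rfl
  rw [h, Finset.mem_map]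
  constructor
  · rintro ⟨a | v, ha, rfl⟩
    · exact .inl ⟨a, by simpa using ha, rfl⟩
    · exact .inr ⟨v, by simpa using ha, rfl⟩
  · rintro (⟨a, ha, rfl⟩ | ⟨v, hv, rfl⟩)
    · exact ⟨.inl a, by simpa using ha, rfl⟩
    · exact ⟨.inr v, by simpa using hv, rfl⟩

theorem card_graphEquiv {k : ℕ} (p : Finset (KEdge k) × Finset (Fin (k + 1))) :
    (graphEquiv k p).card = p.1.card + p.2.card := by
  have h : graphEquiv k p = (p.1.disjSum p.2).map (edgeEquiv k).toEmbedding := rfl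
  rw [h, Finset.card_map, Finset.card_disjSum]

theorem hasIn_graphEquiv_castSucc {k : ℕ} (p : Finset (KEdge k) × Finset (Fin (k + 1)))
    (v : Fin (k + 1)) : HasIn (graphEquiv k p) v.castSucc ↔ HasIn p.1 v := by
  constructor
  · rintro ⟨e, he, h⟩
    obtain ⟨a, ha, rfl⟩ | ⟨u, hu, rfl⟩ := (mem_graphEquiv p e).1 he
    · exact ⟨a, ha, Fin.castSucc_injective _ h⟩
    · exact absurd h.symm (Fin.castSucc_lt_last v).ne
  · rintro ⟨a, ha, rfl⟩
    exact ⟨_, (mem_graphEquiv p _).2 (.inl ⟨a, ha, rfl⟩), rfl⟩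

theorem hasIn_graphEquiv_last {k : ℕ} (p : Finset (KEdge k) × Finset (Fin (k + 1))) :
    HasIn (graphEquiv k p) (Fin.last _) ↔ p.2.Nonempty := by
  constructor
  · rintro ⟨e, he, h⟩
    obtain ⟨a, ha, rfl⟩ | ⟨u, hu, rfl⟩ := (mem_graphEquiv p e).1 he
    · exact absurd h (Fin.castSucc_lt_last _).ne
    · exact ⟨u, hu⟩
  · rintro ⟨v, hv⟩
    exact ⟨_, (mem_graphEquiv p _).2 (.inr ⟨v, hv, rfl⟩), rfl⟩

theorem hasOut_graphEquiv_castSucc {k : ℕ} (p : Finset (KEdge k) × Finset (Fin (k + 1)))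
    (v : Fin (k + 1)) : HasOut (graphEquiv k p) v.castSucc ↔ HasOut p.1 v ∨ v ∈ p.2 := by
  constructor
  · rintro ⟨e, he, h⟩
    obtain ⟨a, ha, rfl⟩ | ⟨u, hu, rfl⟩ := (mem_graphEquiv p e).1 he
    · exact .inl ⟨a, ha, Fin.castSucc_injective _ h⟩
    · exact .inr (Fin.castSucc_injective _ h ▸ hu)
  · rintro (⟨a, ha, rfl⟩ | hv)
    · exact ⟨_, (mem_graphEquiv p _).2 (.inl ⟨a, ha, rfl⟩), rfl⟩
    · exact ⟨_, (mem_graphEquiv p _).2 (.inr ⟨v, hv, rfl⟩), rfl⟩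

theorem not_hasOut_last {n : ℕ} (H : Finset (KEdge n)) : ¬ HasOut H (Fin.last _) :=
  fun h => h.ne_last rfl

/-! ### Weighted counts of subgraphs -/

section Weights

variable {R : Type*} [CommRing R]

/-- The sum over all subgraphs of `K_{k+1}` of `x` to the number of edges, times a weight for each
vertex `v` that depends on whether there are edges into and out of `v`. -/
noncomputable def graphSum (x : R) (k : ℕ) (w : ℕ → Prop → Prop → R) : R :=
  ∑ H : Finset (KEdge k), x ^ H.card * ∏ v : Fin (k + 1), w v (HasIn H v) (HasOut H v)

theorem graphSum_congr (x : R) (k : ℕ) {w w' : ℕ → Prop → Prop → R}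
    (h : ∀ v ≤ k, ∀ i o, w v i o = w' v i o) : graphSum x k w = graphSum x k w' := by
  unfold graphSum
  refine Finset.sum_congr rfl fun H _ => ?_
  congr 1
  exact Finset.prod_congr rfl fun v _ => h v (by omega) _ _

theorem graphSum_zero (x : R) (w : ℕ → Prop → Prop → R) :
    graphSum x 0 w = w 0 False False := by
  have hE : IsEmpty (KEdge 0) := ⟨fun e => by have := e.2; omega⟩
  have h1 : HasIn (∅ : Finset (KEdge 0)) 0 = False := by simp [HasIn]
  have h2 : HasOut (∅ : Finset (KEdge 0)) 0 = False := by simp [HasOut]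
  have h3 : (default : Finset (KEdge 0)) = ∅ := rfl
  simp [graphSum, Finset.univ_unique, h1, h2, h3]

/-- Expanding the product on the right amounts to choosing, for each `v`, whether it lies in `S`. -/
theorem sum_pow_card_mul_prod {ι : Type*} [Fintype ι] [DecidableEq ι] (x : R)
    (g : ι → Prop → R) :
    ∑ S : Finset ι, x ^ S.card * ∏ v, g v (v ∈ S) = ∏ v, (g v False + x * g v True) := by
  simp_rw [add_comm (g _ False)]
  rw [Finset.prod_add, Finset.powerset_univ]
  refine Finset.sum_congr rfl fun S _ => ?_
  have h1 : ∏ v ∈ Finset.univ \ S, g v (v ∈ S) = ∏ v ∈ Finset.univ \ S, g v False :=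
    Finset.prod_congr rfl fun v hv => by rw [eq_false (Finset.mem_sdiff.1 hv).2]
  have h2 : ∏ v ∈ S, g v (v ∈ S) = ∏ v ∈ S, g v True :=
    Finset.prod_congr rfl fun v hv => by rw [eq_true hv]
  rw [← Finset.prod_sdiff (Finset.subset_univ S), Finset.prod_mul_distrib, Finset.prod_const,
    h1, h2]
  ring

/-- Summing over the set `S` of in-neighbours of the last vertex, each earlier vertex independently
omits or takes its edge to it. The second term corrects the contribution of `S = ∅`, the only case
in which the last vertex has no edge in. -/
theorem graphSum_succ (x : R) (k : ℕ) (w : ℕ → Prop → Prop → R) :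
    graphSum x (k + 1) w =
      w (k + 1) True False * graphSum x k (fun v i o => w v i o + x * w v i True) +
        (w (k + 1) False False - w (k + 1) True False) * graphSum x k w := by
  unfold graphSum
  rw [← Equiv.sum_comp (graphEquiv k), Fintype.sum_prod_type, Finset.mul_sum, Finset.mul_sum,
    ← Finset.sum_add_distrib]
  refine Finset.sum_congr rfl fun H _ => ?_
  have key := sum_pow_card_mul_prod x
    (fun (v : Fin (k + 1)) q => w v (HasIn H v) (HasOut H v ∨ q))
  simp only [or_false, or_true] at key
  rw [← key]
  have step : ∀ S : Finset (Fin (k + 1)),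
      x ^ (graphEquiv k (H, S)).card *
        ∏ v : Fin (k + 2), w v (HasIn (graphEquiv k (H, S)) v) (HasOut (graphEquiv k (H, S)) v) =
      w (k + 1) True False * (x ^ H.card *
        (x ^ S.card * ∏ v : Fin (k + 1), w v (HasIn H v) (HasOut H v ∨ v ∈ S))) +
      if S = ∅ then (w (k + 1) False False - w (k + 1) True False) *
        (x ^ H.card * ∏ v : Fin (k + 1), w v (HasIn H v) (HasOut H v)) else 0 := by
    intro S
    rw [Fin.prod_univ_castSucc, card_graphEquiv]
    simp only [hasIn_graphEquiv_castSucc, hasOut_graphEquiv_castSucc, hasIn_graphEquiv_last,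
      eq_false (not_hasOut_last _), Fin.val_castSucc, Fin.val_last, pow_add]
    split_ifs with hS
    · subst hS
      simp
      ring
    · rw [eq_true (Finset.nonempty_iff_ne_empty.2 hS)]
      ring
  rw [Finset.sum_congr rfl fun S _ => step S, Finset.sum_add_distrib, Finset.sum_ite_eq' ,
    ← Finset.mul_sum, ← Finset.mul_sum]
  simp

open Classical in
/-- Vertex weights for subgraphs in which every vertex but the first has an edge in, and every
vertex has an edge out, possibly to further vertices: `B` counts the sets of edges to these. -/
noncomputable def primitiveWeight (B : R) (v : ℕ) (i o : Prop) : R :=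
  if v = 0 ∨ i then (if o then B else B - 1) else 0

open Classical in
/-- Vertex weights for subgraphs in which every vertex but the first has an edge in if and only if
it has an edge out, possibly to further vertices: `B` counts the sets of edges to these. -/
noncomputable def balancedWeight (x B : R) (v : ℕ) (i o : Prop) : R :=
  if v = 0 then B else if i then (if o then B else B - 1) else (if o then 0 else x)

/-- The edge to the deleted vertex is one more optional edge: `B + x * B` and `(B - 1) + x * B` are
the old weights at `(1 + x) * B`. -/
theorem graphSum_primitiveWeight_succ (x B : R) (k : ℕ) :
    graphSum x (k + 1) (primitiveWeight B) =
      (B - 1) * (graphSum x k (primitiveWeight ((1 + x) * B)) -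
        graphSum x k (primitiveWeight B)) := by
  have h : (fun v i o => primitiveWeight B v i o + x * primitiveWeight B v i True) =
      primitiveWeight ((1 + x) * B) := by
    funext v i o
    unfold primitiveWeight
    split_ifs <;> ring
  rw [graphSum_succ, h]
  simp [primitiveWeight]
  ring

/-- This differs from the primitive recursion only in that a last vertex without edges in has weight
`x` rather than `0`. -/
theorem graphSum_balancedWeight_succ (x B : R) (k : ℕ) :
    graphSum x (k + 1) (balancedWeight x B) =
      (B - 1) * (graphSum x k (balancedWeight x ((1 + x) * B)) -
        graphSum x k (balancedWeight x B)) + x * graphSum x k (balancedWeight x B) := by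
  have h : (fun v i o => balancedWeight x B v i o + x * balancedWeight x B v i True) =
      balancedWeight x ((1 + x) * B) := by
    funext v i o
    unfold balancedWeight
    split_ifs <;> ring
  rw [graphSum_succ, h]
  simp [balancedWeight]
  ring

/-- The recursion shifts `B` to `(1 + x) * B`, so `B` must stay general: the induction hypothesis is
used at both values. Stating the left side at `(1 + x) * B` avoids division by `1 + x`. -/
theorem graphSum_balancedWeight_eq (x B : R) (k : ℕ) :
    graphSum x (k + 1) (balancedWeight x ((1 + x) * B)) =
      (1 + x) ^ (k + 2) * B * (graphSum x k (primitiveWeight ((1 + x) * B)) -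
        graphSum x k (primitiveWeight B)) := by
  induction k generalizing B with
  | zero =>
    rw [graphSum_balancedWeight_succ]
    simp [graphSum_zero, balancedWeight, primitiveWeight]
    ring
  | succ k ih =>
    rw [graphSum_balancedWeight_succ, ih, ih, graphSum_primitiveWeight_succ,
      graphSum_primitiveWeight_succ]
    ring

/-- The last vertex carries no condition on its edges in. -/
theorem graphSum_balanced (x : R) (k : ℕ) (w : ℕ → Prop → Prop → R)
    (hw : ∀ v ≤ k, ∀ i o, w v i o = balancedWeight x 1 v i o)
    (hlast : ∀ i, w (k + 1) i False = 1) :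
    graphSum x (k + 1) w = graphSum x k (balancedWeight x (1 + x)) := by
  rw [graphSum_succ, hlast, hlast, sub_self, zero_mul, add_zero, one_mul]
  refine graphSum_congr x k fun v hv i o => ?_
  rw [hw v hv, hw v hv]
  unfold balancedWeight
  split_ifs <;> simp_all

/-- The subtracted sum removes the graphs in which the last vertex has no edge in. -/
theorem graphSum_primitive (x : R) (k : ℕ) (w : ℕ → Prop → Prop → R)
    (hw : ∀ v ≤ k, ∀ i o, w v i o = primitiveWeight 1 v i o)
    (hlast : w (k + 1) True False = 1) (hlast' : w (k + 1) False False = 0) :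
    graphSum x (k + 1) w =
      graphSum x k (primitiveWeight (1 + x)) - graphSum x k (primitiveWeight 1) := by
  rw [graphSum_succ, hlast, hlast', one_mul, zero_sub, neg_one_mul, ← sub_eq_add_neg]
  congr 1
  · refine graphSum_congr x k fun v hv i o => ?_
    rw [hw v hv, hw v hv]
    unfold primitiveWeight
    split_ifs <;> simp_all
  · exact graphSum_congr x k hw

end Weights

/-! ### Supports of flows -/

theorem sum_out_pos_iff {n : ℕ} {H : Finset (KEdge n)} {f : KEdge n → ℝ} (hf : ∀ e, 0 ≤ f e)
    (hH : ∀ e, e ∈ H ↔ f e ≠ 0) (v : Fin (n + 1)) :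
    0 < ∑ e : KEdge n with e.1.1 = v, f e ↔ HasOut H v := by
  rw [Finset.sum_pos_iff_of_nonneg fun e _ => hf e]
  refine exists_congr fun e => ?_
  rw [hH, Finset.mem_filter, (hf e).lt_iff_ne']
  simp [and_comm]

theorem sum_in_pos_iff {n : ℕ} {H : Finset (KEdge n)} {f : KEdge n → ℝ} (hf : ∀ e, 0 ≤ f e)
    (hH : ∀ e, e ∈ H ↔ f e ≠ 0) (v : Fin (n + 1)) :
    0 < ∑ e : KEdge n with e.1.2 = v, f e ↔ HasIn H v := by
  rw [Finset.sum_pos_iff_of_nonneg fun e _ => hf e]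
  refine exists_congr fun e => ?_
  rw [hH, Finset.mem_filter, (hf e).lt_iff_ne']
  simp [and_comm]

open Classical in
/-- The flow through the vertex `v`, when one unit enters at the first vertex and the flow through
each vertex is distributed evenly over the edges of `H` that start there. -/
noncomputable def throughput {n : ℕ} (H : Finset (KEdge n)) (v : Fin (n + 1)) : ℝ :=
  if v = 0 then 1 else
    ∑ e : KEdge n, if _h : e ∈ H ∧ e.1.2 = v then
      throughput H e.1.1 / ({e' ∈ H | e'.1.1 = e.1.1} : Finset (KEdge n)).card else 0
termination_by v.val
decreasing_by
  rw [← _h.2]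
  exact e.2

open Classical in
/-- The flow that is distributed evenly at each vertex. -/
noncomputable def evenFlow {n : ℕ} (H : Finset (KEdge n)) (e : KEdge n) : ℝ :=
  if e ∈ H then throughput H e.1.1 / ({e' ∈ H | e'.1.1 = e.1.1} : Finset (KEdge n)).card else 0

theorem throughput_zero {n : ℕ} (H : Finset (KEdge n)) : throughput H 0 = 1 := by
  rw [throughput, if_pos rfl]

theorem throughput_of_ne_zero {n : ℕ} (H : Finset (KEdge n)) {v : Fin (n + 1)} (hv : v ≠ 0) :
    throughput H v = ∑ e : KEdge n with e.1.2 = v, evenFlow H e := by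
  rw [throughput, if_neg hv, Finset.sum_filter]
  refine Finset.sum_congr rfl fun e _ => ?_
  by_cases h1 : e ∈ H <;> by_cases h2 : e.1.2 = v <;> simp [evenFlow, h1, h2]

theorem throughput_nonneg {n : ℕ} (H : Finset (KEdge n)) (v : Fin (n + 1)) :
    0 ≤ throughput H v := by
  induction v using WellFoundedLT.induction with
  | ind v ih =>
    by_cases hv : v = 0
    · rw [hv, throughput_zero]
      exact zero_le_one
    · rw [throughput_of_ne_zero H hv]
      refine Finset.sum_nonneg fun e he => ?_
      unfold evenFlow
      split_ifs
      · exact div_nonneg (ih _ ((Finset.mem_filter.1 he).2 ▸ e.2)) (Nat.cast_nonneg _)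
      · exact le_rfl

theorem evenFlow_nonneg {n : ℕ} (H : Finset (KEdge n)) (e : KEdge n) : 0 ≤ evenFlow H e := by
  unfold evenFlow
  split_ifs
  · exact div_nonneg (throughput_nonneg H _) (Nat.cast_nonneg _)
  · exact le_rfl

theorem evenFlow_pos {n : ℕ} {H : Finset (KEdge n)} {e : KEdge n} (he : e ∈ H)
    (ht : 0 < throughput H e.1.1) : 0 < evenFlow H e := by
  rw [evenFlow, if_pos he]
  exact div_pos ht (Nat.cast_pos.2 (Finset.card_pos.2 ⟨e, by simp [he]⟩))

theorem evenFlow_of_notMem {n : ℕ} {H : Finset (KEdge n)} {e : KEdge n} (he : e ∉ H) :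
    evenFlow H e = 0 :=
  if_neg he

theorem sum_out_evenFlow {n : ℕ} {H : Finset (KEdge n)} {v : Fin (n + 1)} (hv : HasOut H v) :
    ∑ e : KEdge n with e.1.1 = v, evenFlow H e = throughput H v := by
  classical
  obtain ⟨e₀, he₀, rfl⟩ := hv
  have hpos : (0 : ℝ) < ({e' ∈ H | e'.1.1 = e₀.1.1} : Finset (KEdge n)).card :=
    Nat.cast_pos.2 (Finset.card_pos.2 ⟨e₀, by simp [he₀]⟩)
  have h : ∀ e ∈ ({e | e.1.1 = e₀.1.1} : Finset (KEdge n)), evenFlow H e =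
      if e ∈ H then throughput H e₀.1.1 /
        ({e' ∈ H | e'.1.1 = e₀.1.1} : Finset (KEdge n)).card else 0 := by
    intro e he
    rw [evenFlow, (Finset.mem_filter.1 he).2]
  rw [Finset.sum_congr rfl h, ← Finset.sum_filter, Finset.sum_const, nsmul_eq_mul,
    Finset.filter_filter]
  have h' : ({e | e.1.1 = e₀.1.1 ∧ e ∈ H} : Finset (KEdge n)) =
      ({e' ∈ H | e'.1.1 = e₀.1.1} : Finset (KEdge n)) := by
    ext e
    simp [and_comm]
  rw [h', mul_div_cancel₀]
  exact hpos.ne'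

/-- Conservation makes outflow positive exactly when inflow plus netflow is. Conversely, `evenFlow`
has support `H`: by induction along the vertex order, every vertex with an edge out receives
positive flow. -/
theorem isValidSubgraph_iff {n : ℕ} (H : Finset (KEdge n)) :
    IsValidSubgraph (cryNetflow n) H ↔
      ∀ i : Fin n, HasOut H i.castSucc ↔ (i : ℕ) = 0 ∨ HasIn H i.castSucc := by
  constructor
  · rintro ⟨f, ⟨hf, hnet⟩, hH⟩ i
    have h := hnet i
    rw [← sum_out_pos_iff hf hH, ← sum_in_pos_iff hf hH]
    have h0 : 0 ≤ ∑ e : KEdge n with e.1.2 = i.castSucc, f e :=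
      Finset.sum_nonneg fun e _ => hf e
    by_cases hi : (i : ℕ) = 0
    · simp only [cryNetflow, hi, if_true, Nat.cast_one] at h
      simp only [hi, true_or, iff_true]
      linarith
    · simp only [cryNetflow, hi, if_false, Nat.cast_zero, sub_eq_zero] at h
      simp [hi, h]
  · intro hH
    have hpos : ∀ v : Fin (n + 1), HasOut H v → 0 < throughput H v := by
      intro v
      induction v using WellFoundedLT.induction with
      | ind v ih =>
        intro hv
        by_cases h0 : v = 0
        · rw [h0, throughput_zero]
          exact zero_lt_one
        obtain ⟨i, rfl⟩ := Fin.exists_castSucc_eq.2 hv.ne_last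
        have hi : (i : ℕ) ≠ 0 := fun h => h0 (Fin.ext h)
        obtain ⟨e, he, hev⟩ := ((hH i).1 hv).resolve_left hi
        rw [throughput_of_ne_zero H h0]
        refine Finset.sum_pos' (fun e _ => evenFlow_nonneg H e) ⟨e, by simp [hev], ?_⟩
        exact evenFlow_pos he (ih _ (hev ▸ e.2) ⟨e, he, rfl⟩)
    refine ⟨evenFlow H, ⟨evenFlow_nonneg H, fun i => ?_⟩, fun e => ?_⟩
    · by_cases hi : (i : ℕ) = 0
      · have h0 : i.castSucc = 0 := Fin.ext hi
        rw [sum_out_evenFlow ((hH i).2 (.inl hi)), h0, throughput_zero]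
        rw [Finset.sum_eq_zero fun e he => ?_]
        · simp [cryNetflow, hi]
        · exact absurd (Finset.mem_filter.1 he).2 (Fin.ne_zero_of_lt e.2)
      · simp only [cryNetflow, hi, if_false, Nat.cast_zero, sub_eq_zero]
        have h0 : i.castSucc ≠ 0 := fun h => hi (congrArg Fin.val h)
        by_cases ho : HasOut H i.castSucc
        · rw [sum_out_evenFlow ho, throughput_of_ne_zero H h0]
        · have hin : ¬ HasIn H i.castSucc := fun h => ho ((hH i).2 (.inr h))
          rw [Finset.sum_eq_zero, Finset.sum_eq_zero]
          · exact fun e he => evenFlow_of_notMem fun h => hin ⟨e, h, (Finset.mem_filter.1 he).2⟩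
          · exact fun e he => evenFlow_of_notMem fun h => ho ⟨e, h, (Finset.mem_filter.1 he).2⟩
    · constructor
      · exact fun he => (evenFlow_pos he (hpos _ ⟨e, he, rfl⟩)).ne'
      · exact fun h => by_contra fun he => h (evenFlow_of_notMem he)

/-! ### Betti numbers -/

/-- At each interior vertex there is an edge in if and only if there is an edge out. -/
def IsBalanced {n : ℕ} (H : Finset (KEdge n)) : Prop :=
  ∀ i : Fin n, (i : ℕ) ≠ 0 → (HasIn H i.castSucc ↔ HasOut H i.castSucc)

theorem IsValidSubgraph.isBalanced {n : ℕ} {H : Finset (KEdge n)}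
    (h : IsValidSubgraph (cryNetflow n) H) : IsBalanced H := fun i hi => by
  simpa [hi] using ((isValidSubgraph_iff H).1 h i).symm

theorem IsBalanced.hasOut_of_hasIn {n : ℕ} {H : Finset (KEdge n)} (h : IsBalanced H)
    {v : Fin (n + 1)} (hv : v ≠ Fin.last n) (hin : HasIn H v) : HasOut H v := by
  obtain ⟨i, rfl⟩ := Fin.exists_castSucc_eq.2 hv
  exact (h i fun h0 => hin.ne_zero (Fin.ext h0)).1 hin

theorem underlyingGraph_adj_of_mem {n : ℕ} {H : Finset (KEdge n)} {e : KEdge n} (he : e ∈ H) :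
    (underlyingGraph H).Adj e.1.1 e.1.2 :=
  (SimpleGraph.fromRel_adj _ _ _).2 ⟨e.2.ne, .inl ⟨e, he, rfl⟩⟩

theorem hasOut_or_hasIn_of_adj {n : ℕ} {H : Finset (KEdge n)} {u v : Fin (n + 1)}
    (h : (underlyingGraph H).Adj u v) : HasOut H u ∨ HasIn H u := by
  obtain ⟨-, ⟨e, he, h⟩ | ⟨e, he, h⟩⟩ := (SimpleGraph.fromRel_adj _ _ _).1 h
  · exact .inl ⟨e, he, by rw [h]⟩
  · exact .inr ⟨e, he, by rw [h]⟩

/-- Edges increase the index, so following edges out must stop. -/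
theorem exists_reachable_not_hasOut {n : ℕ} (H : Finset (KEdge n)) (v : Fin (n + 1)) :
    ∃ u, ¬ HasOut H u ∧ (underlyingGraph H).Reachable u v := by
  induction v using WellFoundedGT.induction with
  | ind v ih =>
    by_cases hv : HasOut H v
    · obtain ⟨e, he, rfl⟩ := hv
      obtain ⟨u, hu, hr⟩ := ih e.1.2 e.2
      exact ⟨u, hu, hr.trans (underlyingGraph_adj_of_mem he).symm.reachable⟩
    · exact ⟨v, hv, .rfl⟩

/-- By balance, a vertex other than the last without edges out has no edges in either, so it is
isolated. -/
theorem IsBalanced.eq_of_reachable {n : ℕ} {H : Finset (KEdge n)} (h : IsBalanced H)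
    {u v : Fin (n + 1)} (hu : ¬ HasOut H u) (hl : u ≠ Fin.last n)
    (hr : (underlyingGraph H).Reachable u v) : u = v := by
  obtain ⟨p⟩ := hr
  cases p with
  | nil => rfl
  | cons ha _ =>
    exact absurd ((hasOut_or_hasIn_of_adj ha).elim id (h.hasOut_of_hasIn hl)) hu

theorem IsBalanced.card_connectedComponent {n : ℕ} {H : Finset (KEdge n)} (h : IsBalanced H) :
    Nat.card (underlyingGraph H).ConnectedComponent = Nat.card {v // ¬ HasOut H v} := by
  symm
  refine Nat.card_congr (Equiv.ofBijective
    (fun v => (underlyingGraph H).connectedComponentMk v.1) ⟨?_, ?_⟩)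
  · rintro ⟨u, hu⟩ ⟨v, hv⟩ huv
    have hr := SimpleGraph.ConnectedComponent.exact huv
    by_cases hl : u = Fin.last n
    · by_cases hl' : v = Fin.last n
      · exact Subtype.ext (hl.trans hl'.symm)
      · exact Subtype.ext (h.eq_of_reachable hv hl' hr.symm).symm
    · exact Subtype.ext (h.eq_of_reachable hu hl hr)
  · intro c
    induction c using SimpleGraph.ConnectedComponent.ind with
    | _ v =>
      obtain ⟨u, hu, hr⟩ := exists_reachable_not_hasOut H v
      exact ⟨⟨u, hu⟩, SimpleGraph.ConnectedComponent.sound hr⟩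

theorem card_not_hasOut {n : ℕ} (H : Finset (KEdge n)) :
    Nat.card {v // ¬ HasOut H v} + Nat.card {v // HasOut H v} = n + 1 := by
  classical
  rw [Nat.card_eq_fintype_card, Nat.card_eq_fintype_card, Fintype.card_subtype_compl,
    Fintype.card_fin]
  have := Fintype.card_subtype_le (HasOut H)
  rw [Fintype.card_fin] at this
  omega

theorem IsBalanced.firstBetti_eq {n : ℕ} {H : Finset (KEdge n)} (h : IsBalanced H) :
    firstBetti H = H.card - Nat.card {v // HasOut H v} := by
  have := card_not_hasOut H
  rw [firstBetti, h.card_connectedComponent]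
  omega

theorem isPrimitive_valid_iff {n : ℕ} (H : Finset (KEdge n)) :
    IsValidSubgraph (cryNetflow n) H ∧ IsPrimitiveSubgraph H ↔
      ∀ i : Fin n, HasOut H i.castSucc ∧ HasIn H i.succ := by
  constructor
  · rintro ⟨hv, hp⟩
    have hout : ∀ u : Fin (n + 1), u ≠ Fin.last n → HasOut H u := fun u hu => by
      by_contra ho
      exact hu (hv.isBalanced.eq_of_reachable ho hu (hp.preconnected _ _))
    intro i
    refine ⟨hout _ (Fin.castSucc_lt_last i).ne, ?_⟩
    by_cases hi : i.succ = Fin.last n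
    -- Here `i.castSucc` is the last vertex but one, so its edge out can only end at the last
    -- vertex.
    · obtain ⟨e, he, hei⟩ := hout _ (Fin.castSucc_lt_last i).ne
      refine ⟨e, he, ?_⟩
      have h1 := e.2
      rw [hei] at h1
      have h2 : ((i.succ : Fin (n + 1)) : ℕ) = n := by rw [hi]; rfl
      apply Fin.ext
      have h3 := e.1.2.2
      rw [Fin.lt_def] at h1
      simp at h1 h2 ⊢
      omega
    · obtain ⟨j, hj⟩ := Fin.exists_castSucc_eq.2 hi
      have ho := hout _ hi
      rw [← hj] at ho ⊢
      refine (hv.isBalanced j fun h0 => ?_).2 ho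
      have := congrArg Fin.val hj
      simp [h0] at this
  · intro h
    have hv : IsValidSubgraph (cryNetflow n) H := by
      rw [isValidSubgraph_iff]
      intro i
      refine iff_of_true (h i).1 ?_
      by_cases hi : (i : ℕ) = 0
      · exact .inl hi
      · right
        have := (h ⟨i - 1, by omega⟩).2
        convert this using 1
        apply Fin.ext
        simp
        omega
    refine ⟨hv, ?_⟩
    have hlast : ∀ u, ¬ HasOut H u → u = Fin.last n := fun u hu => by
      by_contra hl
      obtain ⟨i, rfl⟩ := Fin.exists_castSucc_eq.2 hl
      exact hu (h i).1
    refine SimpleGraph.connected_iff_exists_forall_reachable _ |>.2 ⟨Fin.last n, fun v => ?_⟩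
    obtain ⟨u, hu, hr⟩ := exists_reachable_not_hasOut H v
    exact hlast u hu ▸ hr

/-! ### Faces of the Chan-Robbins-Yuen polytope -/

/-- The netflow of `f` at the vertex `v`, as a linear functional. -/
noncomputable def netflow {n : ℕ} (v : Fin (n + 1)) : (KEdge n → ℝ) →ₗ[ℝ] ℝ :=
  ∑ e : KEdge n with e.1.1 = v, LinearMap.proj e - ∑ e : KEdge n with e.1.2 = v, LinearMap.proj e

theorem netflow_apply {n : ℕ} (v : Fin (n + 1)) (f : KEdge n → ℝ) :
    netflow v f = ∑ e : KEdge n with e.1.1 = v, f e - ∑ e : KEdge n with e.1.2 = v, f e := by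
  simp [netflow]

theorem netflow_single {n : ℕ} (v : Fin (n + 1)) (e : KEdge n) :
    netflow v (Pi.single e 1) =
      (if e.1.1 = v then 1 else 0) - (if e.1.2 = v then 1 else 0) := by
  simp [netflow_apply, Pi.single_apply]

theorem isFlow_iff {n : ℕ} (a : Fin n → ℕ) (f : KEdge n → ℝ) :
    IsFlow a f ↔ (∀ e, 0 ≤ f e) ∧ ∀ i : Fin n, netflow i.castSucc f = a i := by
  simp only [IsFlow, netflow_apply]

/-- The circulations with support in `H`. -/
noncomputable def circulations {n : ℕ} (H : Finset (KEdge n)) : Submodule ℝ (KEdge n → ℝ) where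
  carrier := {f | (∀ e ∉ H, f e = 0) ∧ ∀ i : Fin n, netflow i.castSucc f = 0}
  add_mem' {f g} hf hg := ⟨fun e he => by simp [hf.1 e he, hg.1 e he],
    fun i => by simp [hf.2 i, hg.2 i]⟩
  zero_mem' := ⟨fun _ _ => rfl, fun _ => map_zero _⟩
  smul_mem' c f hf := ⟨fun e he => by simp [hf.1 e he], fun i => by simp [hf.2 i]⟩

theorem mem_circulations {n : ℕ} {H : Finset (KEdge n)} {f : KEdge n → ℝ} :
    f ∈ circulations H ↔ (∀ e ∉ H, f e = 0) ∧ ∀ i : Fin n, netflow i.castSucc f = 0 :=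
  Iff.rfl

/-- The values on the edges outside `H`, and the netflow at the vertices with edges out. -/
noncomputable def circulationConstraints {n : ℕ} (H : Finset (KEdge n)) :
    (KEdge n → ℝ) →ₗ[ℝ] ({e // e ∉ H} → ℝ) × ({v // HasOut H v} → ℝ) :=
  (LinearMap.pi fun e => LinearMap.proj e.1).prod (LinearMap.pi fun v => netflow v.1)

/-- At a non-last vertex without edges out, balance makes conservation automatic. Dropping these
redundant equations leaves an independent system. -/
theorem ker_circulationConstraints {n : ℕ} {H : Finset (KEdge n)} (h : IsBalanced H) :
    LinearMap.ker (circulationConstraints H) = circulations H := by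
  ext f
  have hker : circulationConstraints H f = 0 ↔
      (∀ e ∉ H, f e = 0) ∧ ∀ v, HasOut H v → netflow v f = 0 := by
    rw [Prod.ext_iff, funext_iff, funext_iff]
    exact and_congr ⟨fun h e he => h ⟨e, he⟩, fun h e => h e.1 e.2⟩
      ⟨fun h v hv => h ⟨v, hv⟩, fun h v => h v.1 v.2⟩
  rw [LinearMap.mem_ker, mem_circulations, hker]
  refine and_congr_right fun hf => ⟨fun hv i => ?_, fun hi v hv => ?_⟩
  · by_cases ho : HasOut H i.castSucc
    · exact hv _ ho
    · rw [netflow_apply, Finset.sum_eq_zero, Finset.sum_eq_zero, sub_zero]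
      · exact fun e he => hf e fun hm => ho (h.hasOut_of_hasIn (Fin.castSucc_lt_last i).ne
          ⟨e, hm, (Finset.mem_filter.1 he).2⟩)
      · exact fun e he => hf e fun hm => ho ⟨e, hm, (Finset.mem_filter.1 he).2⟩
  · obtain ⟨i, rfl⟩ := Fin.exists_castSucc_eq.2 hv.ne_last
    exact hi i

/-- A functional vanishing on the range yields a potential `c` on the vertices with equal values at
the two ends of every edge of `H`. Since `c` is zero where no edge leaves, following edges out
forces `c = 0`; the edges outside `H` then kill the remaining coordinates. -/
theorem range_circulationConstraints {n : ℕ} (H : Finset (KEdge n)) :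
    LinearMap.range (circulationConstraints H) = ⊤ := by
  classical
  by_contra hne
  obtain ⟨φ, hφ, hker⟩ := Submodule.exists_le_ker_of_lt_top _ (lt_top_iff_ne_top.2 hne)
  apply hφ
  set c : Fin (n + 1) → ℝ := fun v =>
    if h : HasOut H v then φ (0, Pi.single ⟨v, h⟩ 1) else 0 with hc
  have hval : ∀ e, φ (circulationConstraints H (Pi.single e 1)) = 0 :=
    fun e => hker (LinearMap.mem_range_self _ _)
  have hite : ∀ (u : Fin (n + 1)) (v : {v // HasOut H v}), (if u = v.1 then (1 : ℝ) else 0) =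
      (if h : HasOut H u then Pi.single ⟨u, h⟩ 1 else 0 : {v // HasOut H v} → ℝ) v := by
    intro u v
    split_ifs with h1 h2 h2
    · simp [h1]
    · exact absurd (h1 ▸ v.2) h2
    · simp [Subtype.ext_iff, Ne.symm h1]
    · rfl
  have hsnd : ∀ e, φ (0, (circulationConstraints H (Pi.single e 1)).2) = c e.1.1 - c e.1.2 := by
    intro e
    have h1 : (circulationConstraints H (Pi.single e 1)).2 =
        (if h : HasOut H e.1.1 then Pi.single ⟨e.1.1, h⟩ 1 else 0) -
          (if h : HasOut H e.1.2 then Pi.single ⟨e.1.2, h⟩ 1 else 0) := by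
      funext v
      change netflow v.1 (Pi.single e 1) = _
      rw [netflow_single, Pi.sub_apply, hite, hite]
    have h2 : ∀ a b : {v // HasOut H v} → ℝ, φ (0, a - b) = φ (0, a) - φ (0, b) := by
      intro a b
      rw [← map_sub, Prod.mk_sub_mk, sub_zero]
    have h3 : φ (0, 0) = 0 := map_zero φ
    rw [h1, h2, hc]
    congr 1 <;> dsimp only <;> split_ifs <;> first | rfl | exact h3
  have hsplit : ∀ x, φ x = φ (x.1, 0) + φ (0, x.2) := by
    intro x
    rw [← map_add, Prod.mk_add_mk, add_zero, zero_add]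
  have hc0 : ∀ v, c v = 0 := by
    intro v
    induction v using WellFoundedGT.induction with
    | ind v ih =>
      by_cases hv : HasOut H v
      · obtain ⟨e, he, rfl⟩ := hv
        have h1 := hval e
        rw [hsplit, hsnd, ih _ e.2, sub_zero] at h1
        have h2 : (circulationConstraints H (Pi.single e 1)).1 = 0 := by
          funext e'
          change (Pi.single e 1 : KEdge n → ℝ) e'.1 = 0
          exact Pi.single_eq_of_ne (fun h => e'.2 (by rwa [h])) _
        rw [h2] at h1
        have h3 : φ (0, 0) = 0 := map_zero φ
        rwa [h3, zero_add] at h1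
      · exact dif_neg hv
  refine LinearMap.prod_ext (LinearMap.pi_ext' fun e => LinearMap.ext_ring ?_)
    (LinearMap.pi_ext' fun v => LinearMap.ext_ring ?_)
  · have h1 := hval e.1
    rw [hsplit, hsnd, hc0, hc0, sub_zero, add_zero] at h1
    have h2 : (circulationConstraints H (Pi.single e.1 1)).1 = Pi.single e 1 := by
      funext e'
      change (Pi.single e.1 1 : KEdge n → ℝ) e'.1 = _
      simp [Pi.single_apply, Subtype.ext_iff]
    rw [h2] at h1
    simpa using h1
  · have h1 := hc0 v.1
    simp only [hc, dif_pos v.2] at h1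
    simpa using h1

theorem IsBalanced.finrank_circulations {n : ℕ} {H : Finset (KEdge n)} (h : IsBalanced H) :
    (Module.finrank ℝ (circulations H) : ℤ) = firstBetti H := by
  classical
  have h1 := LinearMap.finrank_range_add_finrank_ker (circulationConstraints H)
  rw [range_circulationConstraints, ker_circulationConstraints h, finrank_top,
    Module.finrank_prod, Module.finrank_fintype_fun_eq_card, Module.finrank_fintype_fun_eq_card,
    Module.finrank_fintype_fun_eq_card, Fintype.card_subtype_compl, Fintype.card_coe] at h1
  rw [h.firstBetti_eq, Nat.card_eq_fintype_card]
  have h2 := Finset.card_le_univ H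
  omega

/-- The face of the flows with support in `H`. -/
def cryFace {n : ℕ} (H : Finset (KEdge n)) : Set (KEdge n → ℝ) :=
  {f ∈ cryPolytope n | ∀ e ∉ H, f e = 0}

theorem mem_cryFace {n : ℕ} {H : Finset (KEdge n)} {f : KEdge n → ℝ} :
    f ∈ cryFace H ↔
      ((∀ e, 0 ≤ f e) ∧ ∀ i : Fin n, netflow i.castSucc f = cryNetflow n i) ∧
        ∀ e ∉ H, f e = 0 := by
  rw [← isFlow_iff]
  rfl

theorem exists_pos_forall_nonneg_add {ι : Type*} [Finite ι] {p z : ι → ℝ} (hp : ∀ e, 0 ≤ p e)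
    (hz : ∀ e, p e = 0 → z e = 0) : ∃ ε > 0, ∀ e, 0 ≤ p e + ε * z e := by
  have h : ∀ᶠ ε in nhdsWithin (0 : ℝ) (Set.Ioi 0), ∀ e, 0 ≤ p e + ε * z e := by
    rw [Filter.eventually_all]
    intro e
    rcases (hp e).eq_or_lt with h0 | h0
    · exact Filter.Eventually.of_forall fun ε => by rw [hz e h0.symm, ← h0]; simp
    · have ht : Filter.Tendsto (fun ε : ℝ => p e + ε * z e) (nhds 0) (nhds (p e)) := by
        have : Continuous fun ε : ℝ => p e + ε * z e := by fun_prop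
        simpa using this.tendsto 0
      exact nhdsWithin_le_nhds ((ht.eventually (lt_mem_nhds h0)).mono fun _ h => h.le)
  obtain ⟨ε, hε, hpos⟩ := (h.and self_mem_nhdsWithin).exists
  exact ⟨ε, hpos, hε⟩

/-- A flow with support exactly `H` is a relative interior point: it can be moved a little along any
circulation on `H`. -/
theorem vectorSpan_cryFace {n : ℕ} {H : Finset (KEdge n)}
    (h : IsValidSubgraph (cryNetflow n) H) : vectorSpan ℝ (cryFace H) = circulations H := by
  apply le_antisymm
  · rw [vectorSpan_def, Submodule.span_le]
    rintro _ ⟨f, hf, g, hg, rfl⟩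
    rw [mem_cryFace] at hf hg
    refine mem_circulations.2 ⟨fun e he => ?_, fun i => ?_⟩
    · simp [hf.2 e he, hg.2 e he]
    · simp [hf.1.2 i, hg.1.2 i]
  · intro z hz
    obtain ⟨p, hp, hsupp⟩ := h
    rw [isFlow_iff] at hp
    have hz0 : ∀ e, p e = 0 → z e = 0 := fun e he => hz.1 e fun hm => (hsupp e).1 hm he
    obtain ⟨ε, hε, hpos⟩ := exists_pos_forall_nonneg_add hp.1 hz0
    have hpF : p ∈ cryFace H :=
      mem_cryFace.2 ⟨hp, fun e he => by_contra fun h0 => he ((hsupp e).2 h0)⟩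
    have hqF : p + ε • z ∈ cryFace H := by
      refine mem_cryFace.2 ⟨⟨hpos, fun i => ?_⟩, fun e he => ?_⟩
      · rw [map_add, map_smul, hz.2 i, hp.2 i]
        simp
      · rw [Pi.add_apply, Pi.smul_apply, hz.1 e he, (mem_cryFace.1 hpF).2 e he]
        simp
    have hm := vsub_mem_vectorSpan ℝ hqF hpF
    rw [vsub_eq_sub, add_sub_cancel_left] at hm
    simpa [smul_smul, inv_mul_cancel₀ hε.ne'] using Submodule.smul_mem _ ε⁻¹ hm

theorem IsValidSubgraph.cryFace_nonempty {n : ℕ} {H : Finset (KEdge n)}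
    (h : IsValidSubgraph (cryNetflow n) H) : (cryFace H).Nonempty := by
  obtain ⟨p, hp, hsupp⟩ := h
  exact ⟨p, hp, fun e he => by_contra fun h0 => he ((hsupp e).2 h0)⟩

theorem faceDim_cryFace {n : ℕ} {H : Finset (KEdge n)}
    (h : IsValidSubgraph (cryNetflow n) H) : faceDim (cryFace H) = firstBetti H := by
  rw [faceDim, if_neg h.cryFace_nonempty.ne_empty, vectorSpan_cryFace h,
    h.isBalanced.finrank_circulations]

theorem cryFace_injOn (n : ℕ) :
    Set.InjOn cryFace {H : Finset (KEdge n) | IsValidSubgraph (cryNetflow n) H} := by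
  have key : ∀ H H' : Finset (KEdge n), IsValidSubgraph (cryNetflow n) H →
      cryFace H ⊆ cryFace H' → H ⊆ H' := by
    rintro H H' ⟨p, hp, hsupp⟩ hs e he
    have := hs (a := p) ⟨hp, fun e he => by_contra fun h0 => he ((hsupp e).2 h0)⟩
    exact by_contra fun he' => (hsupp e).1 he (this.2 e he')
  exact fun H hH H' hH' h => (key H H' hH h.subset).antisymm (key H' H hH' h.symm.subset)

theorem isExposed_cryFace {n : ℕ} (H : Finset (KEdge n)) :
    IsExposed ℝ (cryPolytope n) (cryFace H) := by
  classical
  rintro ⟨p, hp, hp0⟩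
  -- This functional is at most `0` on the polytope, with equality exactly on the face; `p` shows
  -- that the value `0` is attained.
  refine ⟨-∑ e ∈ Finset.univ \ H, ContinuousLinearMap.proj e, ?_⟩
  ext f
  have hsum : ∀ g ∈ cryPolytope n, 0 ≤ ∑ e ∈ Finset.univ \ H, g e :=
    fun g hg => Finset.sum_nonneg fun e _ => hg.1 e
  simp only [cryFace, Set.mem_ofPred_eq, neg_apply,
    sum_apply, ContinuousLinearMap.proj_apply, neg_le_neg_iff]
  refine and_congr_right fun hf => ⟨fun h g hg => ?_, fun h e he => ?_⟩
  · rw [Finset.sum_eq_zero fun e he => h e (by simpa using he)]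
    exact hsum g hg
  · have h1 := h p hp
    rw [Finset.sum_eq_zero fun e he => hp0 e (by simpa using he)] at h1
    exact (Finset.sum_eq_zero_iff_of_nonneg fun e _ => hf.1 e).1 (h1.antisymm (hsum f hf)) e
      (by simpa using he)

theorem convex_cryPolytope (n : ℕ) : Convex ℝ (cryPolytope n) := by
  intro f hf g hg a b ha hb hab
  have hf' := (isFlow_iff _ f).1 hf
  have hg' := (isFlow_iff _ g).1 hg
  refine (isFlow_iff _ _).2 ⟨fun e => ?_, fun i => ?_⟩
  · exact add_nonneg (mul_nonneg ha (hf'.1 e)) (mul_nonneg hb (hg'.1 e))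
  · rw [map_add, map_smul, map_smul, hf'.2 i, hg'.2 i, ← add_smul, hab, one_smul]

/-- Every non-empty face consists of the flows with support in some valid subgraph. -/
theorem exists_eq_cryFace {n : ℕ} {F : Set (KEdge n → ℝ)} (hF : IsExposed ℝ (cryPolytope n) F)
    (hne : F.Nonempty) : ∃ H, IsValidSubgraph (cryNetflow n) H ∧ F = cryFace H := by
  classical
  let supp : (KEdge n → ℝ) → Finset (KEdge n) := fun f => {e | f e ≠ 0}
  have hmem : ∀ f e, e ∈ supp f ↔ f e ≠ 0 := fun f e => by simp [supp]
  -- A maximal support contains all others, because the midpoint of two points of `F` has the union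
  -- of their supports.
  obtain ⟨H, ⟨⟨p, hpF, rfl⟩, hmax⟩⟩ : ∃ H, Maximal (· ∈ supp '' F) H :=
    (Set.toFinite (supp '' F)).exists_maximal (hne.image supp)
  have hsub : ∀ q ∈ F, supp q ⊆ supp p := by
    intro q hq
    have hm : (1 / 2 : ℝ) • p + (1 / 2 : ℝ) • q ∈ F :=
      hF.convex (convex_cryPolytope n) hpF hq (by norm_num) (by norm_num) (by norm_num)
    have hval : ∀ e, ((1 / 2 : ℝ) • p + (1 / 2 : ℝ) • q) e = (p e + q e) / 2 := fun e => by
      simp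
      ring
    have hp0 := fun e => (hF.subset hpF).1 e
    have hq0 := fun e => (hF.subset hq).1 e
    have hle : supp p ≤ supp ((1 / 2 : ℝ) • p + (1 / 2 : ℝ) • q) := by
      intro e he
      rw [hmem] at he ⊢
      rw [hval]
      have h1 := (hp0 e).lt_of_ne' he
      have h2 := hq0 e
      positivity
    intro e he
    refine hmax ⟨_, hm, rfl⟩ hle ?_
    rw [hmem] at he ⊢
    rw [hval]
    have h1 := (hq0 e).lt_of_ne' he
    have h2 := hp0 e
    positivity
  refine ⟨supp p, ⟨p, hF.subset hpF, hmem p⟩, Set.Subset.antisymm (fun q hq => ?_) fun q hq => ?_⟩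
  · refine ⟨hF.subset hq, fun e he => ?_⟩
    by_contra h0
    exact he (hsub q hq ((hmem q e).2 h0))
  · obtain ⟨l, rfl⟩ := hF hne
    have hp := (isFlow_iff _ p).1 hpF.1
    have hq' := mem_cryFace.1 hq
    -- The segment from `q` to `p` can be prolonged beyond `p` inside the polytope. As `l` is
    -- maximal at `p`, it cannot be smaller at `q`.
    obtain ⟨ε, hε, hpos⟩ := exists_pos_forall_nonneg_add (p := p) (z := p - q) hp.1 fun e he => by
      rw [Pi.sub_apply, he, hq'.2 e (by simp [hmem, he]), sub_zero]
    have hr : p + ε • (p - q) ∈ cryPolytope n := by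
      refine (isFlow_iff _ _).2 ⟨hpos, fun i => ?_⟩
      rw [map_add, map_smul, map_sub, hp.2 i, hq'.1.2 i, sub_self, smul_zero, add_zero]
    have h1 := hpF.2 _ hr
    rw [map_add, map_smul, map_sub, smul_eq_mul] at h1
    have h2 : l p ≤ l q := by nlinarith
    exact ⟨hq.1, fun y hy => (hpF.2 y hy).trans h2⟩

open Classical in
/-- The valid subgraphs for the netflow vector `(1, 0, …, 0)`. -/
noncomputable def cryValidSubgraphs (n : ℕ) : Finset (Finset (KEdge n)) :=
  {H | IsValidSubgraph (cryNetflow n) H}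

theorem mem_cryValidSubgraphs {n : ℕ} {H : Finset (KEdge n)} :
    H ∈ cryValidSubgraphs n ↔ IsValidSubgraph (cryNetflow n) H := by
  simp [cryValidSubgraphs]

open Classical in
/-- All faces of the Chan-Robbins-Yuen polytope. -/
noncomputable def cryFaces (n : ℕ) : Finset (Set (KEdge n → ℝ)) :=
  insert ∅ ((cryValidSubgraphs n).image cryFace)

theorem coe_cryFaces (n : ℕ) : (cryFaces n : Set (Set (KEdge n → ℝ))) =
    polytopeFaces (cryPolytope n) := by
  ext F
  simp only [cryFaces, Finset.coe_insert, Finset.coe_image, Set.mem_insert_iff, Set.mem_image,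
    Finset.mem_coe, mem_cryValidSubgraphs, polytopeFaces, Set.mem_ofPred_eq]
  constructor
  · rintro (rfl | ⟨H, -, rfl⟩)
    · exact isExposed_empty
    · exact isExposed_cryFace H
  · intro hF
    rcases F.eq_empty_or_nonempty with h | h
    · exact .inl h
    · obtain ⟨H, hH, rfl⟩ := exists_eq_cryFace hF h
      exact .inr ⟨H, hH, rfl⟩

/-! ### From faces to a sum over valid subgraphs. -/

theorem sum_cryFaces {M : Type*} [AddCommMonoid M] (n : ℕ) (g : ℤ → M) :
    ∑ F ∈ cryFaces n, g (faceDim F) = g (-1) + ∑ H ∈ cryValidSubgraphs n, g (firstBetti H) := by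
  classical
  rw [cryFaces, Finset.sum_insert, Finset.sum_image]
  · congr 1
    · simp [faceDim]
    · exact Finset.sum_congr rfl fun H hH => by rw [faceDim_cryFace (mem_cryValidSubgraphs.1 hH)]
  · exact fun H hH H' hH' =>
      cryFace_injOn n (mem_cryValidSubgraphs.1 hH) (mem_cryValidSubgraphs.1 hH')
  · intro h
    obtain ⟨H, hH, h0⟩ := Finset.mem_image.1 h
    exact (mem_cryValidSubgraphs.1 hH).cryFace_nonempty.ne_empty h0

theorem ncard_polytopeFaces (n : ℕ) :
    (polytopeFaces (cryPolytope n)).ncard = 1 + (cryValidSubgraphs n).card := by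
  have h := sum_cryFaces n fun _ => 1
  rw [← coe_cryFaces, Set.ncard_coe_finset]
  simpa using h

theorem faceDim_mem_Icc {E : Type*} [AddCommGroup E] [Module ℝ E] [TopologicalSpace E]
    [FiniteDimensional ℝ E] (F : Set E) :
    faceDim F ∈ Finset.Icc (-1 : ℤ) (Module.finrank ℝ E) := by
  rw [faceDim, Finset.mem_Icc]
  split_ifs
  · omega
  · have := Submodule.finrank_le (vectorSpan ℝ F)
    omega

theorem fPolynomial_eq_sum {E : Type*} [AddCommGroup E] [Module ℝ E] [TopologicalSpace E]
    [FiniteDimensional ℝ E] {P : Set E} {s : Finset (Set E)}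
    (hs : (s : Set (Set E)) = polytopeFaces P) :
    fPolynomial P = ∑ F ∈ s, LaurentPolynomial.T (faceDim F) := by
  classical
  rw [fPolynomial, ← Finset.sum_fiberwise_of_maps_to (fun F _ => faceDim_mem_Icc F)]
  refine Finset.sum_congr rfl fun d _ => ?_
  have h1 : fVector P d = ({F ∈ s | faceDim F = d} : Finset (Set E)).card := by
    rw [fVector, ← Set.ncard_coe_finset, Finset.coe_filter, ← hs]
    rfl
  rw [Finset.sum_congr rfl fun F hF => by rw [(Finset.mem_filter.1 hF).2], Finset.sum_const, h1,
    nsmul_eq_mul]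
  simp

theorem fPolynomial_cryPolytope (n : ℕ) :
    fPolynomial (cryPolytope n) = LaurentPolynomial.T (-1) +
      ∑ H ∈ cryValidSubgraphs n, LaurentPolynomial.T (firstBetti H) := by
  rw [fPolynomial_eq_sum (coe_cryFaces n), sum_cryFaces]

/-! ### Comparison of the two polynomials -/

/-- Following edges backwards from any edge can only stop at the first vertex. -/
theorem IsBalanced.hasOut_zero {n : ℕ} {H : Finset (KEdge n)} (h : IsBalanced H)
    (hne : H.Nonempty) : HasOut H 0 := by
  have key : ∀ v : Fin (n + 1), HasOut H v → HasOut H 0 := by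
    intro v
    induction v using WellFoundedLT.induction with
    | ind v ih =>
      intro hv
      by_cases h0 : v = 0
      · exact h0 ▸ hv
      · obtain ⟨i, rfl⟩ := Fin.exists_castSucc_eq.2 hv.ne_last
        obtain ⟨e, he, hei⟩ := (h i fun hi => h0 (Fin.ext hi)).2 hv
        exact ih e.1.1 (hei ▸ e.2) ⟨e, he, rfl⟩
  obtain ⟨e, he⟩ := hne
  exact key e.1.1 ⟨e, he, rfl⟩

theorem isBalanced_iff {m : ℕ} (H : Finset (KEdge (m + 1))) :
    IsBalanced H ↔ H = ∅ ∨ IsValidSubgraph (cryNetflow (m + 1)) H := by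
  constructor
  · intro h
    refine or_iff_not_imp_left.2 fun hne => (isValidSubgraph_iff H).2 fun i => ?_
    by_cases hi : (i : ℕ) = 0
    · have h0 : i.castSucc = 0 := Fin.ext hi
      simp [hi, h0, h.hasOut_zero (Finset.nonempty_iff_ne_empty.2 hne)]
    · simp [hi, h i hi]
  · rintro (rfl | h)
    · exact fun i _ => by simp [HasIn, HasOut]
    · exact h.isBalanced

theorem not_isValidSubgraph_empty (m : ℕ) :
    ¬ IsValidSubgraph (cryNetflow (m + 1)) ∅ := fun h => by
  simpa [HasOut] using ((isValidSubgraph_iff _).1 h 0).2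

/-- The number of vertices but the last one without edges out. -/
noncomputable def sinkCount {n : ℕ} (H : Finset (KEdge n)) : ℕ :=
  Nat.card {i : Fin n // ¬ HasOut H i.castSucc}

/-- This turns the Betti number into an exponent that is a sum of local contributions; the shift by
`n` also makes it a natural number. -/
theorem IsBalanced.card_add_sinkCount {n : ℕ} {H : Finset (KEdge n)} (h : IsBalanced H) :
    ((H.card + sinkCount H : ℕ) : ℤ) = firstBetti H + n := by
  classical
  have h1 : Nat.card {v // ¬ HasOut H v} = sinkCount H + 1 := by
    rw [sinkCount, Nat.card_eq_fintype_card, Nat.card_eq_fintype_card, Fintype.card_subtype,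
      Fintype.card_subtype, Fin.univ_castSuccEmb, Finset.filter_cons_of_pos,
      Finset.card_cons, Finset.filter_map, Finset.card_map]
    · rfl
    · exact not_hasOut_last H
  have h2 := card_not_hasOut H
  have h3 := h.firstBetti_eq
  push_cast
  omega

section Weights

variable {R : Type*} [CommRing R]

open Classical in
theorem prod_balancedWeight (x : R) {n : ℕ} (H : Finset (KEdge n)) :
    ∏ i : Fin n, balancedWeight x 1 i (HasIn H i.castSucc) (HasOut H i.castSucc) =
      if IsBalanced H then
        x ^ Nat.card {i : Fin n // (i : ℕ) ≠ 0 ∧ ¬ HasOut H i.castSucc} else 0 := by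
  split_ifs with h
  · rw [Nat.card_eq_fintype_card, Fintype.card_subtype, ← Finset.prod_const, Finset.prod_filter]
    refine Finset.prod_congr rfl fun i _ => ?_
    by_cases hi : (i : ℕ) = 0
    · simp [balancedWeight, hi]
    · have := h i hi
      by_cases ho : HasOut H i.castSucc <;> simp_all [balancedWeight]
  · simp only [IsBalanced, not_forall] at h
    obtain ⟨i, hi, h⟩ := h
    refine Finset.prod_eq_zero (Finset.mem_univ i) ?_
    by_cases ho : HasOut H i.castSucc <;> simp_all [balancedWeight]

/-- The term `x ^ m` comes from the edgeless graph: the `m` interior vertices contribute `x` each,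
the first and last contribute `1`. -/
theorem graphSum_balancedWeight_eq_sum (x : R) (m : ℕ) :
    graphSum x m (balancedWeight x (1 + x)) =
      x ^ m + ∑ H ∈ cryValidSubgraphs (m + 1), x ^ (H.card + sinkCount H) := by
  classical
  let w : ℕ → Prop → Prop → R := fun v i o => if v ≤ m then balancedWeight x 1 v i o else 1
  rw [← graphSum_balanced x m w (fun v hv i o => if_pos hv) fun i => if_neg (by omega), graphSum]
  have hterm : ∀ H : Finset (KEdge (m + 1)),
      x ^ H.card * ∏ v : Fin (m + 2), w v (HasIn H v) (HasOut H v) =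
        if IsBalanced H then
          x ^ (H.card + Nat.card {i : Fin (m + 1) // (i : ℕ) ≠ 0 ∧ ¬ HasOut H i.castSucc})
          else 0 := by
    intro H
    rw [Fin.prod_univ_castSucc]
    have h1 : ∀ i : Fin (m + 1), w i.castSucc (HasIn H i.castSucc) (HasOut H i.castSucc) =
        balancedWeight x 1 i (HasIn H i.castSucc) (HasOut H i.castSucc) :=
      fun i => if_pos (by simp; omega)
    have h2 : ∀ i o, w (Fin.last (m + 1)) i o = 1 := fun i o => if_neg (by simp)
    rw [Finset.prod_congr rfl fun i _ => h1 i, h2, mul_one, prod_balancedWeight, mul_ite,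
      mul_zero, pow_add]
  rw [Finset.sum_congr rfl fun H _ => hterm H, ← Finset.sum_filter]
  have hset : ({H | IsBalanced H} : Finset (Finset (KEdge (m + 1)))) =
      insert ∅ (cryValidSubgraphs (m + 1)) := by
    ext H
    simp [isBalanced_iff, mem_cryValidSubgraphs]
  rw [hset, Finset.sum_insert fun h =>
    not_isValidSubgraph_empty m (mem_cryValidSubgraphs.1 h)]
  congr 1
  · have h1 : Nat.card {i : Fin (m + 1) // (i : ℕ) ≠ 0 ∧
        ¬ HasOut (∅ : Finset (KEdge (m + 1))) i.castSucc} = m := by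
      rw [Nat.card_eq_fintype_card, Fintype.card_subtype]
      simp [HasOut, Finset.filter_ne', Fin.val_eq_zero_iff]
    rw [h1, Finset.card_empty, zero_add]
  · refine Finset.sum_congr rfl fun H hH => ?_
    have h1 := (isValidSubgraph_iff H).1 (mem_cryValidSubgraphs.1 hH)
    rw [sinkCount]
    -- In a valid graph the first vertex has an edge out, so excluding it does not change the count
    -- of sinks.
    congr! 5 with i
    have := h1 i
    tauto

theorem mem_primitiveValidSubgraphs {k : ℕ} {H : Finset (KEdge k)} :
    H ∈ primitiveValidSubgraphs (cryNetflow k) ↔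
      ∀ i : Fin k, HasOut H i.castSucc ∧ HasIn H i.succ := by
  rw [← isPrimitive_valid_iff]
  simp [primitiveValidSubgraphs]

theorem firstBetti_of_mem_primitive {k : ℕ} {H : Finset (KEdge k)}
    (hH : H ∈ primitiveValidSubgraphs (cryNetflow k)) : firstBetti H + k = H.card := by
  have hv : IsValidSubgraph (cryNetflow k) H :=
    ((isPrimitive_valid_iff H).2 (mem_primitiveValidSubgraphs.1 hH)).1
  rw [← hv.isBalanced.card_add_sinkCount]
  have : IsEmpty {i : Fin k // ¬ HasOut H i.castSucc} :=
    ⟨fun i => i.2 (mem_primitiveValidSubgraphs.1 hH i.1).1⟩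
  simp [sinkCount]

open Classical in
theorem sum_primitive_eq_graphSum (x : R) (k : ℕ) :
    ∑ H ∈ primitiveValidSubgraphs (cryNetflow k), x ^ H.card =
      -- The last vertex needs an edge in but none out. The clause `v = 0` matters here only for `k
      -- = 0`, where the single vertex is also the first.
      graphSum x k fun v i o => if v < k then primitiveWeight 1 v i o else
        if v = 0 ∨ i then 1 else 0 := by
  have hset : primitiveValidSubgraphs (cryNetflow k) =
      ({H | ∀ i : Fin k, HasOut H i.castSucc ∧ HasIn H i.succ} : Finset (Finset (KEdge k))) := by
    ext H
    simp [mem_primitiveValidSubgraphs]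
  rw [hset, Finset.sum_filter, graphSum]
  refine Finset.sum_congr rfl fun H _ => ?_
  have hw : ∀ v : Fin (k + 1), (if (v : ℕ) < k then primitiveWeight (1 : R) v (HasIn H v)
      (HasOut H v) else if (v : ℕ) = 0 ∨ HasIn H v then 1 else 0) =
      if (v ≠ 0 → HasIn H v) ∧ (v ≠ Fin.last k → HasOut H v) then 1 else 0 := by
    intro v
    have h1 : (v : ℕ) < k ↔ v ≠ Fin.last k := by
      rw [Ne, Fin.ext_iff, Fin.val_last]
      omega
    have h2 : (v : ℕ) = 0 ↔ v = 0 := by simp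
    unfold primitiveWeight
    simp only [h1, h2]
    split_ifs <;> simp_all
  have hprod : ∏ v : Fin (k + 1),
      (if (v ≠ 0 → HasIn H v) ∧ (v ≠ Fin.last k → HasOut H v) then (1 : R) else 0) =
      if ∀ v : Fin (k + 1), (v ≠ 0 → HasIn H v) ∧ (v ≠ Fin.last k → HasOut H v) then 1 else 0 := by
    simp [Finset.prod_ite_zero]
  rw [Finset.prod_congr rfl fun v _ => hw v, hprod, mul_ite, mul_one, mul_zero]
  refine if_congr ?_ rfl rfl
  rw [forall_and, forall_and, and_comm]
  refine and_congr ⟨fun h v hv => ?_, fun h i => h _ i.succ_ne_zero⟩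
    ⟨fun h v hv => ?_, fun h i => h _ (Fin.castSucc_lt_last i).ne⟩
  · obtain ⟨i, rfl⟩ := Fin.exists_succ_eq.2 hv
    exact h i
  · obtain ⟨i, rfl⟩ := Fin.exists_castSucc_eq.2 hv
    exact h i

theorem sum_valid_eq_sum_primitive (x : R) (m : ℕ) :
    x ^ m + ∑ H ∈ cryValidSubgraphs (m + 1), x ^ (H.card + sinkCount H) =
      (1 + x) ^ (m + 1) * ∑ H ∈ primitiveValidSubgraphs (cryNetflow m), x ^ H.card := by
  classical
  rw [← graphSum_balancedWeight_eq_sum, sum_primitive_eq_graphSum]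
  -- The last vertex is split off on the primitive side, which needs a second vertex; `m = 0` is
  -- checked directly.
  cases m with
  | zero => simp [graphSum_zero, balancedWeight]
  | succ j =>
    rw [graphSum_primitive x j _ (fun v hv i o => if_pos (by omega)) (by simp) (by simp)]
    simpa using graphSum_balancedWeight_eq x 1 j

end Weights

open LaurentPolynomial in
theorem mainTheorem3 (n : ℕ) (hn : 1 ≤ n) :
    (LaurentPolynomial.T 1 : ℤ[T;T⁻¹]) * fPolynomial (cryPolytope n) =
        (1 + LaurentPolynomial.T 1) ^ n * primitiveFPolynomial (cryNetflow (n - 1)) ∧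
      (polytopeFaces (cryPolytope n)).ncard =
        2 ^ n * (primitiveValidSubgraphs (cryNetflow (n - 1))).card := by
  obtain ⟨m, rfl⟩ : ∃ m, n = m + 1 := ⟨n - 1, by omega⟩
  rw [Nat.add_sub_cancel]
  constructor
  · have hT : ∀ k : ℕ, (T 1 : ℤ[T;T⁻¹]) ^ k = T k := fun k => by rw [T_pow, mul_one]
    have h := sum_valid_eq_sum_primitive (T 1 : ℤ[T;T⁻¹]) m
    have hl : (T m : ℤ[T;T⁻¹]) * (T 1 * fPolynomial (cryPolytope (m + 1))) =
        T 1 ^ m + ∑ H ∈ cryValidSubgraphs (m + 1), T 1 ^ (H.card + sinkCount H) := by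
      rw [fPolynomial_cryPolytope, mul_add, mul_add, ← T_add, ← T_add, Finset.mul_sum,
        Finset.mul_sum, hT]
      congr 1
      refine Finset.sum_congr rfl fun H hH => ?_
      rw [hT, (mem_cryValidSubgraphs.1 hH).isBalanced.card_add_sinkCount, ← T_add, ← T_add]
      congr 1
      push_cast
      ring
    have hr : (T m : ℤ[T;T⁻¹]) * primitiveFPolynomial (cryNetflow m) =
        ∑ H ∈ primitiveValidSubgraphs (cryNetflow m), T 1 ^ H.card := by
      rw [primitiveFPolynomial, Finset.mul_sum]
      refine Finset.sum_congr rfl fun H hH => ?_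
      rw [hT, ← firstBetti_of_mem_primitive hH, ← T_add, add_comm]
    -- Multiplying by `x ^ m` turns Betti exponents into the natural exponents of the counting
    -- identity.
    refine (isUnit_T (R := ℤ) m).mul_left_cancel ?_
    rw [hl, h, ← hr]
    ring
  · have h := sum_valid_eq_sum_primitive (1 : ℤ) m
    rw [ncard_polytopeFaces]
    simp only [one_pow, Finset.sum_const, nsmul_eq_mul, mul_one] at h
    norm_num at h
    exact_mod_cast h
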